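/- Let $L$ be a finite-dimensional Lie algebra over a field $k$ of characteristic zero. For $x,y\in L$ put $e_1(x,y)=[x,y]$ and $e_{n+1}(x,y)=[e_n(x,y),y]$ for $n\ge 1$. An element $y\in L$ is called Engel if for every $x\in L$ there exists $n\ge 1$ such that $e_n(x,y)=0$, and strictly Engel if $y$ is Engel and $[x,y]$ is Engel for every $x\in L$. Then $L$ has a largest nilpotent ideal $N$ (an ideal that is nilpotent as a Lie algebra and contains every such ideal), called the nilpotent radical of $L$, and $N$ coincides with the set of all strictly Engel elements of $L$: $$N=\{y\in L : y \text{ is strictly Engel}\}.$$ -/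

import Mathlib

/-- The Engel sequence of the pair `(x, y)`, indexed from zero: the term of index `n` is
`e_{n+1}(x, y)`, where `e_1(x, y) = [x, y]` and `e_{n+1}(x, y) = [e_n(x, y), y]`. -/
def engelSeq {L : Type*} [LieRing L] (x y : L) : ℕ → L
  | 0 => ⁅x, y⁆
  | n + 1 => ⁅engelSeq x y n, y⁆

/-- `y` is an Engel element: for every `x` some term of the Engel sequence of `(x, y)` is zero. -/
def IsEngelElement {L : Type*} [LieRing L] (y : L) : Prop :=
  ∀ x : L, ∃ n : ℕ, engelSeq x y n = 0

/-- `y` is strictly Engel: `y` is Engel, and `[x, y]` is Engel for every `x`. -/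
def IsStrictlyEngelElement {L : Type*} [LieRing L] (y : L) : Prop :=
  IsEngelElement y ∧ ∀ x : L, IsEngelElement ⁅x, y⁆

/-- The nilpotent radical: the supremum (sum) of all ideals that are nilpotent as Lie algebras.
This is not `LieAlgebra.maxNilpotentIdeal`, which only uses the ideals that are nilpotent as
`L`-modules under the adjoint action (this is a stronger condition). -/
def nilpotentRadical (k L : Type*) [CommRing k] [LieRing L] [LieAlgebra k L] : LieIdeal k L :=
  sSup {I : LieIdeal k L | LieRing.IsNilpotent I}

theorem engelSeq_eq_ad_pow (k : Type*) {L : Type*} [CommRing k] [LieRing L] [LieAlgebra k L]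
    (x y : L) (n : ℕ) : engelSeq x y n = ((-LieAlgebra.ad k L y) ^ (n + 1)) x := by
  induction n with
  | zero => simp [engelSeq]
  | succ n ih =>
    rw [pow_succ', Module.End.mul_apply, ← ih, LinearMap.neg_apply, LieAlgebra.ad_apply, lie_skew]
    rfl

/-! In finite dimension, Engel elements are the `ad`-nilpotent ones. An ideal is nilpotent iff its
elements are `ad`-nilpotent in `L`, so `nilpotentRadical`, itself nilpotent, consists of strictly
Engel elements. Conversely, let `y` be strictly Engel and `R` the radical. In `L ⧸ R` the Killing
form is nondegenerate and every `⁅x, y⁆` is `ad`-nilpotent, which forces the image of `y` to vanish;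
so `y ∈ R`. Then `⁅L, y⁆ ⊆ ⁅L, R⁆`, which acts nilpotently on `L` because solvable ideals act
centrally on irreducible modules. By Engel's theorem `y` and `⁅L, R⁆` span a nilpotent ideal. -/

open Polynomial in
/-- In characteristic zero, an endomorphism all of whose positive powers have trace zero is
nilpotent. -/
theorem LinearMap.isNilpotent_of_forall_trace_pow_succ_eq_zero {k V : Type*} [Field k] [CharZero k]
    [AddCommGroup V] [Module k V] [FiniteDimensional k V] (f : Module.End k V)
    (h : ∀ n : ℕ, LinearMap.trace k V (f ^ (n + 1)) = 0) : IsNilpotent f := by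
  have htr (p : k[X]) : LinearMap.trace k V (aeval f (p * X)) = 0 := by
    induction p using Polynomial.induction_on' with
    | add p q hp hq => rw [add_mul, map_add, map_add, hp, hq, add_zero]
    | monomial n a =>
      rw [monomial_mul_X, aeval_monomial, ← Algebra.smul_def, map_smul, h, smul_zero]
  have h0 : minpoly k f ≠ 0 := minpoly.ne_zero (Algebra.IsIntegral.isIntegral f)
  obtain ⟨q, hq, hndvd⟩ := exists_eq_pow_rootMultiplicity_mul_and_not_dvd (minpoly k f) h0 0
  set m := rootMultiplicity 0 (minpoly k f)
  rw [C_0, sub_zero] at hq hndvd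
  -- The Bézout term in `X ^ (m + 1)` is the Fitting projection onto the part where `f` is
  -- invertible. The exponent `m + 1` makes it divisible by `X` even when `m = 0`, so its trace,
  -- which is its rank, is zero.
  have hcop : IsCoprime (X ^ (m + 1)) q :=
    ((Polynomial.prime_X.coprime_iff_not_dvd).mpr hndvd).pow_left
  obtain ⟨u, v, huv⟩ := hcop
  have hmin : aeval f (X ^ m * q) = 0 := by rw [← hq, minpoly.aeval]
  have hsum : aeval f (u * X ^ (m + 1)) + aeval f (v * q) = 1 := by
    rw [← map_add, huv, map_one]
  have hidem : IsIdempotentElem (aeval f (u * X ^ (m + 1))) := by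
    have : aeval f (u * X ^ (m + 1)) * aeval f (v * q) = 0 := by
      rw [← map_mul, show u * X ^ (m + 1) * (v * q) = u * X * v * (X ^ m * q) by ring, map_mul,
        hmin, mul_zero]
    rw [← eq_sub_iff_add_eq'] at hsum
    rw [hsum, mul_sub, mul_one, sub_eq_zero] at this
    exact this.symm
  have he : aeval f (u * X ^ (m + 1)) = 0 := by
    rw [← LinearMap.IsIdempotentElem.trace_eq_zero_iff hidem, pow_succ, ← mul_assoc]
    exact htr _
  refine ⟨m, ?_⟩
  rw [he, zero_add] at hsum
  calc f ^ m = aeval f (X ^ m : k[X]) * aeval f (v * q) := by rw [hsum, mul_one, map_pow, aeval_X]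
    _ = aeval f (v * (X ^ m * q)) := by
      rw [← map_mul, show X ^ m * (v * q) = v * (X ^ m * q) by ring]
    _ = 0 := by rw [map_mul, hmin, mul_zero]

/-! ### Solvable ideals acting on finite-dimensional modules -/

namespace LieModule

variable {k L M : Type*} [Field k] [LieRing L] [LieAlgebra k L]
  [AddCommGroup M] [Module k M] [LieRingModule L M] [LieModule k L M]

/-- An ideal acting by nilpotent endomorphisms on an irreducible module acts trivially. -/
theorem le_ker_of_forall_isNilpotent_toEnd [FiniteDimensional k M] [IsIrreducible k L M]
    (I : LieIdeal k L) (h : ∀ x ∈ I, _root_.IsNilpotent (toEnd k L M x)) :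
    I ≤ LieModule.ker k L M := by
  have hnil : IsNilpotent I M := (isNilpotent_iff_forall' (R := k)).mpr fun x ↦ h x x.2
  obtain ⟨n, hn⟩ := IsNilpotent.nilpotent k I M
  have hlcs : I.lcs M n = ⊥ := by
    simp only [← LieSubmodule.toSubmodule_inj, I.coe_lcs_eq, hn, LieSubmodule.bot_toSubmodule]
  rcases eq_bot_or_eq_top ⁅I, (⊤ : LieSubmodule k L M)⁆ with hb | ht
  · intro x hx
    rw [LieModule.mem_ker]
    intro m
    have := LieSubmodule.lie_mem_lie hx (LieSubmodule.mem_top (R := k) (L := L) m)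
    rwa [hb, LieSubmodule.mem_bot] at this
  · have htop (j : ℕ) : I.lcs M j = ⊤ := by
      induction j with
      | zero => rfl
      | succ j ih => rw [LieIdeal.lcs_succ, ih, ht]
    exact absurd ((htop n).symm.trans hlcs) top_ne_bot

/-- If `⁅J, ⁅I, J⁆⁆` acts trivially on an irreducible module, then so does `⁅I, J⁆`. -/
theorem lie_le_ker_of_lie_lie_le_ker [CharZero k] [FiniteDimensional k M] [IsIrreducible k L M]
    (I J : LieIdeal k L) (h : ⁅J, ⁅I, J⁆⁆ ≤ LieModule.ker k L M) :
    ⁅I, J⁆ ≤ LieModule.ker k L M := by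
  refine le_ker_of_forall_isNilpotent_toEnd _ fun x hx ↦
    LinearMap.isNilpotent_of_forall_trace_pow_succ_eq_zero _ fun n ↦ ?_
  have hcomm (b : L) (hb : b ∈ J) : Commute (toEnd k L M b) (toEnd k L M x ^ n) := by
    refine Commute.pow_right ?_ n
    have := h (LieSubmodule.lie_mem_lie hb hx)
    rw [LieModule.mem_ker] at this
    ext m
    simpa [sub_eq_zero] using this m
  -- Only one factor `x` varies, so linearity reduces to `z = ⁅a, b⁆`; there `b` commutes with `x ^
  -- n` and the trace is cyclic.
  have key : ∀ z ∈ (⁅I, J⁆ : LieIdeal k L).toSubmodule,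
      LinearMap.trace k M (toEnd k L M z * toEnd k L M x ^ n) = 0 := by
    intro z hz
    rw [LieSubmodule.lieIdeal_oper_eq_linear_span'] at hz
    induction hz using Submodule.span_induction with
    | mem z hz =>
      obtain ⟨a, -, b, hb, rfl⟩ := hz
      have hab : toEnd k L M ⁅a, b⁆ =
          toEnd k L M a * toEnd k L M b - toEnd k L M b * toEnd k L M a := by
        ext m; simp
      rw [hab, sub_mul, map_sub, mul_assoc, (hcomm b hb).eq, ← mul_assoc,
        LinearMap.trace_mul_cycle, mul_assoc, sub_self]
    | zero => simp
    | add y z _ _ hy hz => rw [map_add, add_mul, map_add, hy, hz, add_zero]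
    | smul c z _ hz => rw [map_smul, smul_mul_assoc, map_smul, hz, smul_zero]
  rw [pow_succ']
  exact key x hx

open LieAlgebra in
/-- A solvable ideal acts centrally on an irreducible module in characteristic zero. -/
theorem top_lie_le_ker_of_derivedSeriesOfIdeal_le_ker [CharZero k] [FiniteDimensional k M]
    [IsIrreducible k L M] (n : ℕ) (I : LieIdeal k L)
    (h : derivedSeriesOfIdeal k L n I ≤ LieModule.ker k L M) :
    ⁅(⊤ : LieIdeal k L), I⁆ ≤ LieModule.ker k L M := by
  induction n generalizing I with
  | zero => exact (LieSubmodule.lie_le_right _ _).trans h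
  | succ n ih =>
    rw [derivedSeriesOfIdeal_add I n 1, derivedSeriesOfIdeal_succ,
      derivedSeriesOfIdeal_zero] at h
    have hII : ⁅I, I⁆ ≤ LieModule.ker k L M :=
      lie_le_ker_of_lie_lie_le_ker I I ((LieSubmodule.mono_lie_left _ le_top).trans (ih _ h))
    -- Here `⁅I, ⁅⊤, I⁆⁆ ≤ ⁅I, I⁆`, which was just shown to act trivially.
    exact lie_le_ker_of_lie_lie_le_ker ⊤ I
      ((LieSubmodule.mono_lie_right _ (LieSubmodule.lie_le_right _ _)).trans hII)

theorem isNilpotent_toEnd_of_submodule_of_quotient (N : LieSubmodule k L M) (x : L)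
    (hN : _root_.IsNilpotent (toEnd k L N x)) (hQ : _root_.IsNilpotent (toEnd k L (M ⧸ N) x)) :
    _root_.IsNilpotent (toEnd k L M x) := by
  obtain ⟨a, ha⟩ := hN
  obtain ⟨b, hb⟩ := hQ
  refine ⟨a + b, LinearMap.ext fun m ↦ ?_⟩
  have hquot (j : ℕ) (m : M) : LieSubmodule.Quotient.mk' N ((toEnd k L M x ^ j) m) =
      (toEnd k L (M ⧸ N) x ^ j) (LieSubmodule.Quotient.mk' N m) := by
    induction j with
    | zero => rfl
    | succ j ih =>
      rw [pow_succ', pow_succ', Module.End.mul_apply, Module.End.mul_apply, ← ih]; rfl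
  have hsub (j : ℕ) (v : N) : (((toEnd k L N x ^ j) v : N) : M) = (toEnd k L M x ^ j) v := by
    induction j with
    | zero => rfl
    | succ j ih => rw [pow_succ', pow_succ', Module.End.mul_apply, Module.End.mul_apply, ← ih]; rfl
  have hmem : (toEnd k L M x ^ b) m ∈ N := by
    rw [← LieSubmodule.Quotient.mk_eq_zero, hquot, hb, LinearMap.zero_apply]
  rw [pow_add, Module.End.mul_apply]
  have := hsub a ⟨_, hmem⟩
  rw [ha] at this
  exact this.symm

/-- If `R` is a solvable ideal in characteristic zero, then `⁅L, R⁆` acts nilpotently on every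
finite-dimensional module. -/
theorem isNilpotent_toEnd_of_mem_top_lie [CharZero k] [FiniteDimensional k M] (R : LieIdeal k L)
    [LieAlgebra.IsSolvable R] {x : L} (hx : x ∈ ⁅(⊤ : LieIdeal k L), R⁆) :
    _root_.IsNilpotent (toEnd k L M x) := by
  obtain ⟨n, hn⟩ := LieAlgebra.IsSolvable.solvable k R
  rw [LieIdeal.derivedSeries_eq_bot_iff] at hn
  induction hd : Module.finrank k M using Nat.strong_induction_on generalizing M with
  | _ d ih =>
  by_cases hirr : IsIrreducible k L M
  · have := top_lie_le_ker_of_derivedSeriesOfIdeal_le_ker (M := M) n R (hn ▸ bot_le) hx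
    have h0 : toEnd k L M x = 0 := LinearMap.ext ((LieModule.mem_ker k L M x).mp this)
    rw [h0]
    exact IsNilpotent.zero
  cases subsingleton_or_nontrivial M with
  | inl _ => exact ⟨1, Subsingleton.elim _ _⟩
  | inr _ =>
    obtain ⟨N, hbot, htop⟩ : ∃ N : LieSubmodule k L M, N ≠ ⊥ ∧ N ≠ ⊤ := by
      by_contra! hc
      exact hirr (IsIrreducible.mk hc)
    have hlt : N.toSubmodule < ⊤ := lt_top_iff_ne_top.mpr (by simpa using htop)
    have hpos : 0 < Module.finrank k N.toSubmodule := by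
      rw [Module.finrank_pos_iff, Submodule.nontrivial_iff_ne_bot]
      simpa using hbot
    have hadd := Submodule.finrank_quotient_add_finrank N.toSubmodule
    have h1 := Submodule.finrank_lt hlt.ne
    refine isNilpotent_toEnd_of_submodule_of_quotient N x ?_ ?_
    · exact ih (Module.finrank k N.toSubmodule) (hd ▸ h1) rfl
    · have : FiniteDimensional k (M ⧸ N) :=
        inferInstanceAs (FiniteDimensional k (M ⧸ N.toSubmodule))
      exact ih (Module.finrank k (M ⧸ N.toSubmodule)) (by omega) rfl

end LieModule

/-! ### Nilpotent ideals and their sums -/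

namespace LieIdeal

variable {k L M : Type*} [Field k] [LieRing L] [LieAlgebra k L]
  [AddCommGroup M] [Module k M] [LieRingModule L M]

theorem exists_lcs_eq_bot_iff [LieModule k L M] [FiniteDimensional k M] (I : LieIdeal k L) :
    (∃ n, I.lcs M n = ⊥) ↔ ∀ x ∈ I, IsNilpotent (LieModule.toEnd k L M x) := by
  have h : (∃ n, I.lcs M n = ⊥) ↔ LieModule.IsNilpotent I M := by
    rw [LieModule.isNilpotent_iff k]
    simp only [← LieSubmodule.toSubmodule_inj, I.coe_lcs_eq, LieSubmodule.bot_toSubmodule]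
  rw [h, LieModule.isNilpotent_iff_forall' (R := k)]
  exact ⟨fun h x hx ↦ h ⟨x, hx⟩, fun h x ↦ h x x.2⟩

/-- `J` kills each quotient `J.lcs M m / J.lcs M (m + 1)`, so `I ⊔ J` acts there through `I`, and
`n` steps descend one level. -/
theorem lcs_sup_mul_le (I J : LieIdeal k L) {n : ℕ} (hn : I.lcs M n = ⊥) (m : ℕ) :
    (I ⊔ J).lcs M (n * m) ≤ J.lcs M m := by
  induction m with
  | zero => exact le_top
  | succ m ih =>
    have key (i : ℕ) : (I ⊔ J).lcs M (n * m + i) ≤ I.lcs M i ⊓ J.lcs M m ⊔ J.lcs M (m + 1) := by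
      induction i with
      | zero => exact le_sup_of_le_left (le_inf le_top ih)
      | succ i hi =>
        rw [← add_assoc, LieIdeal.lcs_succ]
        refine (LieSubmodule.mono_lie_right _ hi).trans ?_
        rw [LieSubmodule.lie_sup, LieSubmodule.sup_lie, LieIdeal.lcs_succ, LieIdeal.lcs_succ]
        refine sup_le (sup_le (le_sup_of_le_left (le_inf ?_ ?_)) (le_sup_of_le_right ?_))
          (le_sup_of_le_right (LieSubmodule.lie_le_right _ _))
        · exact LieSubmodule.mono_lie_right _ inf_le_left
        · exact (LieSubmodule.lie_le_right _ _).trans inf_le_right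
        · exact LieSubmodule.mono_lie_right _ inf_le_right
    have := key n
    rwa [hn, bot_inf_eq, bot_sup_eq, ← mul_add_one] at this

/-- A finite-dimensional ideal is nilpotent if and only if its elements are `ad`-nilpotent in the
whole Lie algebra. -/
theorem isNilpotent_iff_forall_ad [FiniteDimensional k L] (I : LieIdeal k L) :
    LieRing.IsNilpotent I ↔ ∀ x ∈ I, IsNilpotent (LieAlgebra.ad k L x) := by
  constructor
  · intro h x hx
    obtain ⟨n, hn⟩ := (LieAlgebra.isNilpotent_iff_forall (R := k)).mp h ⟨x, hx⟩
    have hcoe (j : ℕ) (v : I) : (((LieAlgebra.ad k I ⟨x, hx⟩ ^ j) v : I) : L) =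
        (LieAlgebra.ad k L x ^ j) v := by
      induction j with
      | zero => rfl
      | succ j ih =>
        rw [pow_succ', pow_succ', Module.End.mul_apply, Module.End.mul_apply, ← ih]; rfl
    -- The extra bracket moves `y` into `I`.
    refine ⟨n + 1, LinearMap.ext fun y ↦ ?_⟩
    have := hcoe n ⟨⁅x, y⁆, lie_mem_left k L I x y hx⟩
    rw [hn] at this
    rw [pow_succ, Module.End.mul_apply]
    exact this.symm
  · intro h
    rw [LieAlgebra.isNilpotent_iff_forall (R := k)]
    rintro ⟨x, hx⟩
    exact LieSubalgebra.isNilpotent_ad_of_isNilpotent_ad (I : LieSubalgebra k L) (x := ⟨x, hx⟩)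
      (h x hx)

theorem isNilpotent_sup [FiniteDimensional k L] {I J : LieIdeal k L} (hI : LieRing.IsNilpotent I)
    (hJ : LieRing.IsNilpotent J) : LieRing.IsNilpotent (I ⊔ J : LieIdeal k L) := by
  rw [isNilpotent_iff_forall_ad] at *
  obtain ⟨n, hn⟩ := (exists_lcs_eq_bot_iff (M := L) I).mpr hI
  obtain ⟨m, hm⟩ := (exists_lcs_eq_bot_iff (M := L) J).mpr hJ
  exact (exists_lcs_eq_bot_iff (M := L) (I ⊔ J)).mp
    ⟨n * m, le_bot_iff.mp (hm ▸ lcs_sup_mul_le I J hn m)⟩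

/-- If `I` is an ideal acting nilpotently and `y` is `ad`-nilpotent with `⁅L, y⁆ ⊆ I`, then the
ideal spanned by `y` and `I` is nilpotent. -/
theorem exists_isNilpotent_mem [FiniteDimensional k L] (I : LieIdeal k L)
    (hI : ∀ x ∈ I, IsNilpotent (LieAlgebra.ad k L x)) {y : L}
    (hy : IsNilpotent (LieAlgebra.ad k L y)) (hLy : ∀ x : L, ⁅x, y⁆ ∈ I) :
    ∃ J : LieIdeal k L, LieRing.IsNilpotent J ∧ y ∈ J := by
  obtain ⟨J, hJ⟩ : ∃ J : LieIdeal k L, J.toSubmodule = (k ∙ y) ⊔ I.toSubmodule := by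
    refine ⟨{ (k ∙ y) ⊔ I.toSubmodule with lie_mem := ?_ }, rfl⟩
    intro x m hm
    obtain ⟨a, ha, b, hb, rfl⟩ := Submodule.mem_sup.mp hm
    obtain ⟨c, rfl⟩ := Submodule.mem_span_singleton.mp ha
    refine Submodule.mem_sup_right ?_
    rw [lie_add, lie_smul]
    exact add_mem (I.toSubmodule.smul_mem c (hLy x)) (I.lie_mem hb)
  have hmem (z : L) : z ∈ J ↔ z ∈ (k ∙ y) ⊔ I.toSubmodule := by
    rw [← hJ, LieSubmodule.mem_toSubmodule]
  have hyJ : y ∈ J :=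
    (hmem y).mpr (Submodule.mem_sup_left (Submodule.mem_span_singleton_self y))
  refine ⟨J, ?_, hyJ⟩
  have hspan : (k ∙ (⟨y, hyJ⟩ : J)) ⊔ (I.comap J.incl).toSubmodule = ⊤ := by
    rw [eq_top_iff]
    rintro ⟨m, hm⟩ -
    obtain ⟨a, ha, b, hb, rfl⟩ := Submodule.mem_sup.mp ((hmem m).mp hm)
    obtain ⟨c, rfl⟩ := Submodule.mem_span_singleton.mp ha
    have hbJ : b ∈ J := (hmem b).mpr (Submodule.mem_sup_right hb)
    refine Submodule.mem_sup.mpr ⟨c • ⟨y, hyJ⟩, Submodule.mem_span_singleton.mpr ⟨c, rfl⟩,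
      ⟨b, hbJ⟩, ?_, rfl⟩
    exact LieIdeal.mem_comap.mpr hb
  have hJL : LieModule.IsNilpotent J L := by
    refine LieSubmodule.isNilpotentOfIsNilpotentSpanSupEqTop (R := k) (L := J) (M := L)
      (I := I.comap J.incl) (x := ⟨y, hyJ⟩) hspan hy ?_
    rw [LieModule.isNilpotent_iff_forall' (R := k)]
    rintro ⟨z, hz⟩
    exact hI z (LieIdeal.mem_comap.mp hz)
  rw [isNilpotent_iff_forall_ad]
  intro x hx
  exact (LieModule.isNilpotent_iff_forall' (R := k)).mp hJL ⟨x, hx⟩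

end LieIdeal

/-! ### The semisimple quotient and the Killing form -/

namespace LieAlgebra

/-- The quotient of a finite-dimensional Lie algebra by its radical has trivial radical. -/
instance hasTrivialRadical_quotient_radical (k L : Type*) [Field k] [LieRing L] [LieAlgebra k L]
    [FiniteDimensional k L] : HasTrivialRadical k (L ⧸ radical k L) := by
  refine hasTrivialRadical_of_no_solvable_ideals fun J hJ ↦ ?_
  obtain ⟨n, hn⟩ := IsSolvable.solvable k J
  obtain ⟨m, hm⟩ := IsSolvable.solvable k (radical k L)
  rw [LieIdeal.derivedSeries_eq_bot_iff] at hn hm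
  let π : L →ₗ⁅k⁆ L ⧸ radical k L :=
    { (LieSubmodule.Quotient.mk' (radical k L) : L →ₗ[k] L ⧸ radical k L) with
      map_lie' := fun {_ _} ↦ rfl }
  have hle (j : ℕ) : derivedSeriesOfIdeal k L j (J.comap π) ≤
      (derivedSeriesOfIdeal k (L ⧸ radical k L) j J).comap π := by
    induction j with
    | zero => exact le_rfl
    | succ j ih =>
      rw [derivedSeriesOfIdeal_succ, derivedSeriesOfIdeal_succ]
      exact (LieSubmodule.mono_lie ih ih).trans (LieIdeal.comap_bracket_le π)
  have hrad : derivedSeriesOfIdeal k L n (J.comap π) ≤ radical k L := by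
    intro x hx
    have := LieIdeal.mem_comap.mp (hle n hx)
    rw [hn, LieSubmodule.mem_bot] at this
    exact (LieSubmodule.Quotient.mk_eq_zero _).mp this
  have hsolv : IsSolvable (J.comap π) := by
    refine IsSolvable.mk (R := k) (k := m + n) ?_
    rw [LieIdeal.derivedSeries_eq_bot_iff, derivedSeriesOfIdeal_add, ← le_bot_iff, ← hm]
    exact derivedSeriesOfIdeal_mono hrad m
  rw [LieIdeal.solvable_iff_le_radical] at hsolv
  rw [eq_bot_iff]
  intro x hx
  obtain ⟨x, rfl⟩ := LieSubmodule.Quotient.surjective_mk' _ x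
  exact (LieSubmodule.Quotient.mk_eq_zero _).mpr (hsolv (LieIdeal.mem_comap.mpr hx))

/-- In a Lie algebra with nondegenerate Killing form, an element `y` such that all `⁅x, y⁆` are
`ad`-nilpotent vanishes. -/
theorem IsKilling.eq_zero_of_forall_isNilpotent_ad_lie {k L : Type*} [Field k] [CharZero k]
    [LieRing L] [LieAlgebra k L] [FiniteDimensional k L] [IsKilling k L] {y : L}
    (h : ∀ x : L, IsNilpotent (ad k L ⁅x, y⁆)) : y = 0 := by
  have hdiag (x : L) : killingForm k L ⁅x, y⁆ ⁅x, y⁆ = 0 := by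
    rw [killingForm_apply_apply]
    exact (LinearMap.isNilpotent_trace_of_isNilpotent
      ((Commute.refl (ad k L ⁅x, y⁆)).isNilpotent_mul_left (h x))).eq_zero
  have hpolar (x z : L) : killingForm k L ⁅x, y⁆ ⁅z, y⁆ = 0 := by
    have hs := hdiag (x + z)
    rw [add_lie, LinearMap.map_add₂, map_add, map_add, hdiag, hdiag,
      LieModule.traceForm_comm k L L ⁅z, y⁆, zero_add, add_zero, ← two_mul] at hs
    exact (mul_eq_zero.mp hs).resolve_left two_ne_zero
  have hnondeg {w : L} (hw : ∀ x, killingForm k L x w = 0) : w = 0 := by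
    have : w ∈ LieIdeal.killingCompl k L ⊤ := by
      rw [LieIdeal.mem_killingCompl]
      exact fun x _ ↦ hw x
    rwa [IsKilling.killingCompl_top_eq_bot, LieSubmodule.mem_bot] at this
  have hsq (z : L) : ⁅y, ⁅y, z⁆⁆ = 0 := by
    refine hnondeg fun x ↦ ?_
    rw [← LieModule.traceForm_apply_lie_apply k L L, ← lie_skew y z, map_neg, hpolar, neg_zero]
  -- Since `(ad y)² = 0`, expanding `ad ⁅y, ⁅y, x⁆⁆ = 0` leaves only `-2 ad y ad x ad y`. Hence `(ad
  -- x ad y)² = 0`, and `y` is orthogonal to every `x`.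
  have hYXY (x v : L) : ⁅y, ⁅x, ⁅y, v⁆⁆⁆ = 0 := by
    have h1 : ⁅⁅y, ⁅y, x⁆⁆, v⁆ = -(2 : k) • ⁅y, ⁅x, ⁅y, v⁆⁆⁆ := by
      rw [lie_lie, lie_lie, lie_sub, hsq, lie_lie, hsq, lie_zero]
      module
    rw [hsq, zero_lie, eq_comm, smul_eq_zero] at h1
    exact h1.resolve_left (by simp)
  refine hnondeg fun x ↦ ?_
  rw [killingForm_apply_apply]
  refine (LinearMap.isNilpotent_trace_of_isNilpotent ⟨2, LinearMap.ext fun v ↦ ?_⟩).eq_zero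
  simp [pow_two, hYXY]

end LieAlgebra

/-! ### Engel elements and the nilpotent radical -/

theorem isEngelElement_iff_isNilpotent_ad (k : Type*) {L : Type*} [Field k] [LieRing L]
    [LieAlgebra k L] [FiniteDimensional k L] (y : L) :
    IsEngelElement y ↔ IsNilpotent (LieAlgebra.ad k L y) := by
  simp only [IsEngelElement, engelSeq_eq_ad_pow k]
  rw [← isNilpotent_neg_iff]
  constructor
  · intro h
    rw [Module.End.isNilpotent_iff_of_finite]
    exact fun x ↦ (h x).imp' (· + 1) fun _ hn ↦ hn
  · rintro ⟨n, hn⟩ x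
    exact ⟨n, by rw [pow_succ', hn, mul_zero, LinearMap.zero_apply]⟩

section NilpotentRadical

variable {k L : Type*} [Field k] [LieRing L] [LieAlgebra k L] [FiniteDimensional k L]

theorem isNilpotent_nilpotentRadical : LieRing.IsNilpotent (nilpotentRadical k L) := by
  have hwf := LieSubmodule.wellFoundedGT_of_noetherian k L L
  rw [← CompleteLattice.isSupClosedCompact_iff_wellFoundedGT] at hwf
  -- By the ascending chain condition, a nonempty family of ideals closed under binary sums contains
  -- its supremum.
  refine hwf {I : LieIdeal k L | LieRing.IsNilpotent I} ⟨⊥, ?_⟩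
    fun I hI J hJ ↦ LieIdeal.isNilpotent_sup hI hJ
  change LieRing.IsNilpotent (⊥ : LieIdeal k L)
  rw [LieIdeal.isNilpotent_iff_forall_ad]
  intro x hx
  rw [(LieSubmodule.mem_bot x).mp hx, map_zero]
  exact IsNilpotent.zero

theorem isStrictlyEngelElement_of_mem_nilpotentRadical {y : L} (hy : y ∈ nilpotentRadical k L) :
    IsStrictlyEngelElement y := by
  have h := (LieIdeal.isNilpotent_iff_forall_ad _).mp
    (isNilpotent_nilpotentRadical (k := k) (L := L))
  simp only [← isEngelElement_iff_isNilpotent_ad] at h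
  exact ⟨h y hy, fun x ↦ h _ (LieSubmodule.lie_mem _ hy)⟩

theorem IsStrictlyEngelElement.mem_radical [CharZero k] {y : L} (hy : IsStrictlyEngelElement y) :
    y ∈ LieAlgebra.radical k L := by
  have : FiniteDimensional k (L ⧸ LieAlgebra.radical k L) :=
    inferInstanceAs (FiniteDimensional k (L ⧸ (LieAlgebra.radical k L).toSubmodule))
  rw [← LieSubmodule.Quotient.mk_eq_zero]
  -- The quotient has trivial radical, hence nondegenerate Killing form by Cartan's criterion.
  refine LieAlgebra.IsKilling.eq_zero_of_forall_isNilpotent_ad_lie (k := k) fun x ↦ ?_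
  obtain ⟨x, rfl⟩ := LieSubmodule.Quotient.surjective_mk' _ x
  obtain ⟨n, hn⟩ := (isEngelElement_iff_isNilpotent_ad k _).mp (hy.2 x)
  have hquot (j : ℕ) (v : L) : (LieAlgebra.ad k (L ⧸ LieAlgebra.radical k L)
      ⁅LieSubmodule.Quotient.mk' (LieAlgebra.radical k L) x, LieSubmodule.Quotient.mk' _ y⁆ ^ j)
        (LieSubmodule.Quotient.mk' _ v) =
      LieSubmodule.Quotient.mk' _ ((LieAlgebra.ad k L ⁅x, y⁆ ^ j) v) := by
    induction j with
    | zero => rfl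
    | succ j ih => rw [pow_succ', pow_succ', Module.End.mul_apply, Module.End.mul_apply, ih]; rfl
  refine ⟨n, LinearMap.ext fun v ↦ ?_⟩
  obtain ⟨v, rfl⟩ := LieSubmodule.Quotient.surjective_mk' _ v
  rw [hquot, hn]
  simp

theorem IsStrictlyEngelElement.mem_nilpotentRadical [CharZero k] {y : L}
    (hy : IsStrictlyEngelElement y) : y ∈ nilpotentRadical k L := by
  obtain ⟨J, hJ, hyJ⟩ := LieIdeal.exists_isNilpotent_mem
    ⁅(⊤ : LieIdeal k L), LieAlgebra.radical k L⁆
    (fun _ hx ↦ LieModule.isNilpotent_toEnd_of_mem_top_lie _ hx)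
    ((isEngelElement_iff_isNilpotent_ad k y).mp hy.1)
    (fun x ↦ LieSubmodule.lie_mem_lie (LieSubmodule.mem_top x) hy.mem_radical)
  exact le_sSup (a := J) hJ hyJ

end NilpotentRadical

/-- In a finite-dimensional Lie algebra over a field of characteristic zero, the nilpotent radical
is the largest nilpotent ideal, and it is the set of all strictly Engel elements. -/
theorem mainTheorem5 (k L : Type*) [Field k] [CharZero k] [LieRing L] [LieAlgebra k L]
    [FiniteDimensional k L] :
    IsGreatest {I : LieIdeal k L | LieRing.IsNilpotent I} (nilpotentRadical k L) ∧
      (nilpotentRadical k L : Set L) = {y : L | IsStrictlyEngelElement y} :=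
  ⟨⟨isNilpotent_nilpotentRadical, fun _ hI ↦ le_sSup hI⟩,
    Set.ext fun _ ↦ ⟨isStrictlyEngelElement_of_mem_nilpotentRadical,
      IsStrictlyEngelElement.mem_nilpotentRadical⟩⟩
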